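/- Let $(\Omega,\mathcal F,(\mathcal F_t)_{t\in[0,T]},P)$ be a filtered probability space and let $S=(S_t)_{t\in[0,T]}$ be an $\mathbb R^d$-valued adapted process with (almost surely) càdlàg paths, for instance a semimartingale, such that $S^*_T=\sup_{t\le T}|S_t|\in L^1(P)$. Let $\mathcal K$ be the set of terminal gains $$K=\sum_{i=1}^{n-1}H_i\cdot(S_{\tau_{i+1}}-S_{\tau_i})$$ of simple, predictable, bounded strategies $\sum_{i=1}^{n-1}H_i\mathbb 1_{]\tau_i,\tau_{i+1}]}$, where $0\le\tau_1<\dots<\tau_n\le T$ are stopping times and each $H_i$ is $\mathbb R^d$-valued, bounded and $\mathcal F_{\tau_i}$-measurable. For $K\in\mathcal K$ with $P(K\ne0)>0$ put $\alpha(K)=E[K^+]/E[K^-]\in[0,+\infty]$ (equal to $+\infty$ if $E[K^-]=0$), and let $$\alpha^*=\sup_{K\in\mathcal K,\ K\neq0}\alpha(K),$$ where $K\ne0$ means $P(K\ne0)>0$ and $\sup\emptyset=0$. For $\lambda\in[1,+\infty)$ let $U_\lambda(x)=x^+-\lambda x^-$ and $V_\lambda(y)=\sup_{x\in\mathbb R}(U_\lambda(x)-xy)$,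 and let $\mathcal Q_\lambda$ be the set of probabilities $Q\ll P$ on $\mathcal F$ with $E[V_\lambda(y\,\tfrac{dQ}{dP})]<+\infty$ for some $y>0$. Let $\mathcal M$ be the set of martingale measures, i.e. of probabilities $Q\ll P$ on $\mathcal F$ such that $S$ is a $Q$-martingale with respect to $(\mathcal F_t)$. Then: 1. $\mathcal Q_\lambda\cap\mathcal M$ is convex for every $\lambda\ge1$. 2. $\alpha^*<+\infty$ if and only if $\mathcal Q_\lambda\cap\mathcal M\ne\emptyset$ for some $\lambda\ge1$. 3. If $\mathcal K$ contains some $K\ne0$ and $\alpha^*<+\infty$, then $\alpha^*=\min\{\lambda\ge1:\mathcal Q_\lambda\cap\mathcal M\ne\emptyset\}$, the minimum being attained. 4. If $\mathcal K$ contains some $K\neq0$, then $\alpha^*=1$ if and only if $P$ is a martingale measure. -/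

import Mathlib

open MeasureTheory Filter Topology
open scoped ENNReal NNReal

namespace GainLoss

/-- The gain-loss ratio `α(X) = E[X⁺] / E[X⁻]` of an integrable, non-null random variable `X`, as an
element of `[0, ∞]`. It equals `∞` if `X ≥ 0` almost surely. -/
noncomputable def gainLossRatio {Ω : Type*} [MeasurableSpace Ω] (P : Measure Ω) (X : Ω → ℝ) :
    ℝ≥0∞ :=
  (∫⁻ ω, ENNReal.ofReal (max (X ω) 0) ∂P) / (∫⁻ ω, ENNReal.ofReal (max (-X ω) 0) ∂P)

/-- The path `x` on `[0, T]` is right-continuous and has left limits. -/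
def IsCadlag {T : ℝ} {E : Type*} [TopologicalSpace E] (x : Set.Icc (0 : ℝ) T → E) : Prop :=
  ∀ t, ContinuousWithinAt x (Set.Ici t) t ∧ ∃ l, Tendsto x (𝓝[<] t) (𝓝 l)

/-- A simple, predictable and bounded `ℝ^d`-valued strategy `∑ i, H i · 1_{]τ i, τ (i + 1)]}` on
`[0, T]`: the `τ i` are strictly increasing stopping times with values in `[0, T]`, and each `H i`
is bounded and measurable for the σ-algebra of events prior to `τ i`. -/
structure SimpleStrategy {Ω : Type*} [MeasurableSpace Ω] {T : ℝ} (d : ℕ)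
    (ℱ : Filtration (Set.Icc (0 : ℝ) T) ‹MeasurableSpace Ω›) where
  /-- number of trading periods -/
  n : ℕ
  /-- trading dates -/
  τ : Fin (n + 1) → Ω → Set.Icc (0 : ℝ) T
  isStoppingTime : ∀ i, IsStoppingTime ℱ (fun ω => ((τ i ω : Set.Icc (0 : ℝ) T) : WithTop _))
  strictMono : ∀ ω, StrictMono fun i => τ i ω
  /-- positions held on the trading periods -/
  H : Fin n → Ω → EuclideanSpace ℝ (Fin d)
  measurable_H : ∀ i, Measurable[(isStoppingTime i.castSucc).measurableSpace] (H i)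
  bounded_H : ∃ C : ℝ, ∀ i ω, ‖H i ω‖ ≤ C

/-- The terminal gain `(ξ · S)_T = ∑ i, ⟨H i, S_{τ (i + 1)} - S_{τ i}⟩`, i.e. the stochastic
integral over `[0, T]` of the simple strategy `ξ` with respect to `S`. -/
noncomputable def SimpleStrategy.gain {Ω : Type*} [MeasurableSpace Ω] {T : ℝ} {d : ℕ}
    {ℱ : Filtration (Set.Icc (0 : ℝ) T) ‹MeasurableSpace Ω›} (ξ : SimpleStrategy d ℱ)
    (S : Set.Icc (0 : ℝ) T → Ω → EuclideanSpace ℝ (Fin d)) (ω : Ω) : ℝ :=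
  ∑ i : Fin ξ.n, inner ℝ (ξ.H i ω) (S (ξ.τ i.succ ω) ω - S (ξ.τ i.castSucc ω) ω)

/-- The set `𝒦` of terminal gains of simple, predictable, bounded strategies. -/
def gains {Ω : Type*} [MeasurableSpace Ω] {T : ℝ} {d : ℕ}
    (ℱ : Filtration (Set.Icc (0 : ℝ) T) ‹MeasurableSpace Ω›)
    (S : Set.Icc (0 : ℝ) T → Ω → EuclideanSpace ℝ (Fin d)) : Set (Ω → ℝ) :=
  {K | ∃ ξ : SimpleStrategy d ℱ, K = ξ.gain S}

/-- The market best gain-loss ratio `α^*`, the supremum in `[0, ∞]` of `α(K)` over the gains `K`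
that do not vanish almost surely. -/
noncomputable def bestGainLoss {Ω : Type*} [MeasurableSpace Ω] {T : ℝ} {d : ℕ} (P : Measure Ω)
    (ℱ : Filtration (Set.Icc (0 : ℝ) T) ‹MeasurableSpace Ω›)
    (S : Set.Icc (0 : ℝ) T → Ω → EuclideanSpace ℝ (Fin d)) : ℝ≥0∞ :=
  ⨆ K ∈ {K | K ∈ gains ℱ S ∧ ¬ K =ᵐ[P] 0}, gainLossRatio P K

/-- The utility `U_λ(x) = x⁺ - λ x⁻`. -/
noncomputable def utility (lam x : ℝ) : ℝ := max x 0 - lam * max (-x) 0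

/-- The convex conjugate `V_λ(y) = sup_x (U_λ(x) - x y)`. -/
noncomputable def conjugate (lam y : ℝ) : EReal := ⨆ x : ℝ, ((utility lam x - x * y : ℝ) : EReal)

/-- The set `𝒬_λ` of probabilities `Q ≪ P` of finite `V_λ`-entropy: `E[V_λ(y dQ/dP)] < ∞` for some
`y > 0`. (The value `V_λ(y)` is never negative, as the choice `x = 0` shows, so `toENNReal` loses
nothing.) -/
def finiteEntropy {Ω : Type*} [MeasurableSpace Ω] (P : Measure Ω) (lam : ℝ) : Set (Measure Ω) :=
  {Q | IsProbabilityMeasure Q ∧ Q ≪ P ∧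
    ∃ y : ℝ, 0 < y ∧ ∫⁻ ω, (conjugate lam (y * (Q.rnDeriv P ω).toReal)).toENNReal ∂P < ∞}

/-- The set `ℳ` of martingale measures: probabilities `Q ≪ P` under which `S` is a martingale. -/
def martingaleMeasures {Ω : Type*} [MeasurableSpace Ω] {T : ℝ} {d : ℕ} (P : Measure Ω)
    (ℱ : Filtration (Set.Icc (0 : ℝ) T) ‹MeasurableSpace Ω›)
    (S : Set.Icc (0 : ℝ) T → Ω → EuclideanSpace ℝ (Fin d)) : Set (Measure Ω) :=
  {Q | IsProbabilityMeasure Q ∧ Q ≪ P ∧ Martingale S ℱ Q}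

end GainLoss

/-! ### Finite entropy as a two-sided bound on the density. -/

namespace GainLoss

/-! The conjugate `V_λ` is `0` on `[1, λ]` and `∞` elsewhere, so finite entropy means exactly `c P ≤
Q ≤ λ c P` for some `c > 0` (`mem_finiteEntropy_iff`). Convexity follows, since the constants `c`
mix along with the measures.

If such a `Q` is a martingale measure, then `E_Q[K] = 0` for every gain, so `c E[K⁺] ≤ E_Q[K⁺] =
E_Q[K⁻] ≤ λ c E[K⁻]` and `α* ≤ λ`. That `E_Q[K] = 0` is optional stopping
(`integral_eq_zero_of_mem_gains`): stopping times are approximated from the right by grid-valued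
ones, and right-continuity with the integrable bound on `S` allows passage to the limit.

Conversely, let `α* ≤ λ` with `λ ≥ 1`. The sublinear functional `N(f) = λ E[f⁺] - E[f⁻]` is
nonnegative on any linear space of gains, so by Hahn-Banach the zero functional on it extends to
some `g ≤ N`. For `f ≥ 0` this gives `E[f] ≤ g(f) ≤ λ E[f]`, which makes `g` the integral against a
measure `ν` with `P ≤ ν ≤ λ P`; normalising `ν` gives the martingale measure. The linear space used
is spanned by trades between two deterministic dates: these suffice to test the martingale property,
and their combinations are again gains of simple strategies.

Thus the admissible `λ ≥ 1` are those with `α* ≤ λ`. If some gain `K` is not null, `K` or `-K` has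
ratio at least `1`, so `α* ≥ 1` is the minimum. The case `α* = 1` is settled by `𝒬_1 = {P}`. -/

theorem conjugate_eq_zero {lam y : ℝ} (h1 : 1 ≤ y) (h2 : y ≤ lam) : conjugate lam y = 0 := by
  apply le_antisymm
  · refine iSup_le fun x => ?_
    rw [← EReal.coe_zero, EReal.coe_le_coe_iff]
    unfold utility
    rcases le_total 0 x with hx | hx
    · rw [max_eq_left hx, max_eq_right (by linarith)]
      nlinarith
    · rw [max_eq_right hx, max_eq_left (by linarith)]
      nlinarith
  · refine le_iSup_of_le 0 ?_
    simp [utility]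

theorem conjugate_eq_top {lam y : ℝ} (h : ¬(1 ≤ y ∧ y ≤ lam)) : conjugate lam y = ⊤ := by
  rw [EReal.eq_top_iff_forall_lt]
  intro r
  have hr : r < |r| + 1 := (le_abs_self r).trans_lt (lt_add_one _)
  have hpos : 0 < |r| + 1 := by positivity
  by_cases h1 : 1 ≤ y
  · have h2 : 0 < y - lam := by
      by_contra h'
      exact h ⟨h1, by linarith⟩
    -- For `x < 0` the objective is `(lam - y) * x`, so this `x` makes it equal to `|r| + 1`.
    refine lt_of_lt_of_le (EReal.coe_lt_coe_iff.2 hr) (le_iSup_of_le (-((|r| + 1) / (y - lam))) ?_)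
    rw [EReal.coe_le_coe_iff]
    have hx : 0 < (|r| + 1) / (y - lam) := by positivity
    have hx' : (|r| + 1) / (y - lam) * (y - lam) = |r| + 1 := by field_simp
    unfold utility
    rw [max_eq_right (by linarith), max_eq_left (by linarith)]
    nlinarith
  · have h2 : 0 < 1 - y := by linarith
    refine lt_of_lt_of_le (EReal.coe_lt_coe_iff.2 hr) (le_iSup_of_le ((|r| + 1) / (1 - y)) ?_)
    rw [EReal.coe_le_coe_iff]
    have hx : 0 < (|r| + 1) / (1 - y) := by positivity
    have hx' : (|r| + 1) / (1 - y) * (1 - y) = |r| + 1 := by field_simp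
    unfold utility
    rw [max_eq_left (by linarith), max_eq_right (by linarith)]
    nlinarith

variable {Ω : Type*} [MeasurableSpace Ω]

theorem lintegral_conjugate_lt_top_iff {P : Measure Ω} {lam : ℝ} {f : Ω → ℝ} (hf : Measurable f) :
    ∫⁻ ω, (conjugate lam (f ω)).toENNReal ∂P < ∞ ↔ ∀ᵐ ω ∂P, 1 ≤ f ω ∧ f ω ≤ lam := by
  have hm : MeasurableSet {ω | ¬(1 ≤ f ω ∧ f ω ≤ lam)} :=
    ((measurableSet_le measurable_const hf).inter (measurableSet_le hf measurable_const)).compl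
  have heq : (fun ω => (conjugate lam (f ω)).toENNReal)
      = Set.indicator {ω | ¬(1 ≤ f ω ∧ f ω ≤ lam)} fun _ => ∞ := by
    funext ω
    by_cases h : 1 ≤ f ω ∧ f ω ≤ lam
    · rw [conjugate_eq_zero h.1 h.2, Set.indicator_of_notMem (by simpa using h)]
      simp
    · rw [conjugate_eq_top h, Set.indicator_of_mem h]
      simp
  rw [heq, lintegral_indicator_const hm, ae_iff]
  by_cases h0 : P {ω | ¬(1 ≤ f ω ∧ f ω ≤ lam)} = 0
  · rw [h0]
    simp
  · rw [ENNReal.top_mul h0]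
    simpa using h0

theorem smul_eq_withDensity (P : Measure Ω) (c : ℝ≥0) :
    c • P = P.withDensity fun _ => (c : ℝ≥0∞) := by
  rw [withDensity_const]
  rfl

/-- Finite entropy forces `y dQ/dP ∈ [1, lam]` almost surely; take `c = 1 / y`. Inequalities between
measures are easier to integrate and to combine than bounds on densities. -/
theorem mem_finiteEntropy_iff {P Q : Measure Ω} [IsProbabilityMeasure P] {lam : ℝ} :
    Q ∈ finiteEntropy P lam ↔ IsProbabilityMeasure Q ∧
      ∃ c : ℝ≥0, 0 < c ∧ c • P ≤ Q ∧ Q ≤ (lam.toNNReal * c) • P := by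
  constructor
  · rintro ⟨hQ, hac, y, hy, hfin⟩
    refine ⟨hQ, Real.toNNReal y⁻¹, by simpa using hy, ?_, ?_⟩
    all_goals
      rw [lintegral_conjugate_lt_top_iff
        ((Q.measurable_rnDeriv P).ennreal_toReal.const_mul y)] at hfin
      have hrn : ∀ᵐ ω ∂P, Q.rnDeriv P ω < ∞ := Q.rnDeriv_lt_top P
    · rw [← Measure.withDensity_rnDeriv_eq _ _ hac, smul_eq_withDensity]
      refine withDensity_mono ?_
      filter_upwards [hfin, hrn] with ω h1 h2
      rw [← ENNReal.ofReal_toReal h2.ne, ← ENNReal.ofReal]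
      refine ENNReal.ofReal_le_ofReal ?_
      rw [inv_le_iff_one_le_mul₀' hy]
      exact h1.1
    · have : ((lam.toNNReal * Real.toNNReal y⁻¹ : ℝ≥0) : ℝ≥0∞) = ENNReal.ofReal (lam / y) := by
        rw [ENNReal.ofReal, div_eq_mul_inv, mul_comm,
          mul_comm lam, Real.toNNReal_mul (by positivity)]
      conv_lhs => rw [← Measure.withDensity_rnDeriv_eq _ _ hac]
      rw [smul_eq_withDensity, this]
      refine withDensity_mono ?_
      filter_upwards [hfin, hrn] with ω h1 h2
      rw [← ENNReal.ofReal_toReal h2.ne]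
      refine ENNReal.ofReal_le_ofReal ?_
      rw [le_div_iff₀ hy, mul_comm]
      exact h1.2
  · rintro ⟨hQ, c, hc, h1, h2⟩
    have hac : Q ≪ P := Measure.absolutelyContinuous_of_le_smul h2
    refine ⟨hQ, hac, (c : ℝ)⁻¹, by positivity, ?_⟩
    rw [lintegral_conjugate_lt_top_iff
        ((Q.measurable_rnDeriv P).ennreal_toReal.const_mul _)]
    have hrn : ∀ᵐ ω ∂P, Q.rnDeriv P ω < ∞ := Q.rnDeriv_lt_top P
    have hlow : (fun _ => (c : ℝ≥0∞)) ≤ᵐ[P] Q.rnDeriv P := by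
      refine ae_le_of_forall_setLIntegral_le_of_sigmaFinite measurable_const fun s hs _ => ?_
      rw [Measure.setLIntegral_rnDeriv hac, setLIntegral_const]
      exact h1 s
    have hup : Q.rnDeriv P ≤ᵐ[P] fun _ => ((lam.toNNReal * c : ℝ≥0) : ℝ≥0∞) := by
      refine ae_le_of_forall_setLIntegral_le_of_sigmaFinite (Q.measurable_rnDeriv P)
        fun s hs _ => ?_
      rw [Measure.setLIntegral_rnDeriv hac, setLIntegral_const]
      exact h2 s
    filter_upwards [hrn, hlow, hup] with ω h3 h4 h5
    have hc' : (0 : ℝ) < c := by exact_mod_cast hc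
    have h4' : (c : ℝ) ≤ (Q.rnDeriv P ω).toReal := by
      simpa using ENNReal.toReal_mono h3.ne h4
    have h5' : (Q.rnDeriv P ω).toReal ≤ lam.toNNReal * c := by
      simpa using ENNReal.toReal_mono ENNReal.coe_ne_top h5
    -- Nothing is assumed on `lam`; were it nonpositive, `lam.toNNReal` would be `0`, against the
    -- density being at least `c > 0`.
    have hlam : 0 < lam := by
      by_contra h
      rw [Real.toNNReal_of_nonpos (not_lt.1 h)] at h5'
      simp only [NNReal.coe_zero, zero_mul] at h5'
      linarith
    rw [Real.coe_toNNReal _ hlam.le] at h5'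
    constructor
    · rw [inv_mul_eq_div, le_div_iff₀ hc']
      linarith
    · rw [inv_mul_eq_div, div_le_iff₀ hc']
      exact h5'

end GainLoss

/-! ### Hahn-Banach and the representation of the functional by a measure. -/

namespace GainLoss
variable {Ω : Type*} [MeasurableSpace Ω]

/-- The space of integrable real functions, as functions and not up to almost sure equality. -/
def integrableFunctions (P : Measure Ω) : Submodule ℝ (Ω → ℝ) where
  carrier := {f | Integrable f P}
  add_mem' := fun hf hg => Integrable.add hf hg
  zero_mem' := integrable_zero _ _ _
  smul_mem' := fun c _ hf => Integrable.smul c hf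

theorem integrable_max_mul {P : Measure Ω} {f : Ω → ℝ} (hf : Integrable f P) (lam : ℝ) :
    Integrable (fun ω => max (f ω) (lam * f ω)) P :=
  hf.sup (hf.const_mul lam)

/-- A linear functional on the integrable functions that lies between `E` and `lam • E` on the
nonnegative ones is the integral against a measure between `P` and `lam • P`. -/
theorem exists_measure_eq_integral {P : Measure Ω} [IsProbabilityMeasure P] {lam : ℝ}
    (hlam : 1 ≤ lam) (g : integrableFunctions P →ₗ[ℝ] ℝ)
    (hlow : ∀ f : integrableFunctions P, 0 ≤ f.1 → ∫ ω, f.1 ω ∂P ≤ g f)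
    (hup : ∀ f : integrableFunctions P, 0 ≤ f.1 → g f ≤ lam * ∫ ω, f.1 ω ∂P) :
    ∃ ν : Measure Ω, P ≤ ν ∧ ν ≤ lam.toNNReal • P ∧
      ∀ f : integrableFunctions P, g f = ∫ ω, f.1 ω ∂ν := by
  classical
  have hind : ∀ s, MeasurableSet s → Integrable (s.indicator fun _ => (1 : ℝ)) P :=
    fun s hs => (integrable_const 1).indicator hs
  let I : ∀ s, MeasurableSet s → integrableFunctions P := fun s hs => ⟨_, hind s hs⟩
  have hI0 : ∀ s hs, 0 ≤ (I s hs).1 := fun s hs => Set.indicator_nonneg fun _ _ => zero_le_one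
  have hI : ∀ s hs, ∫ ω, (I s hs).1 ω ∂P = P.real s := fun s hs => by
    simp [I, integral_indicator_const, hs]
  have hg0 : ∀ s hs, 0 ≤ g (I s hs) := fun s hs =>
    le_trans (by rw [hI s hs]; exact measureReal_nonneg) (hlow _ (hI0 s hs))
  have hadd : ∀ s t (hs : MeasurableSet s) (ht : MeasurableSet t), Disjoint s t →
      g (I (s ∪ t) (hs.union ht)) = g (I s hs) + g (I t ht) := fun s t hs ht hd => by
    rw [← map_add]
    congr 1
    apply Subtype.ext
    exact Set.indicator_union_of_disjoint hd _
  -- Linearity of `g` gives finite additivity on indicators; domination by `lam * P` upgrades it to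
  -- countable additivity.
  let m : ∀ s : Set Ω, MeasurableSet s → ℝ≥0∞ := fun s hs => ENNReal.ofReal (g (I s hs))
  have mlow : ∀ s hs, P s ≤ m s hs := fun s hs => by
    rw [← ofReal_measureReal (μ := P) (s := s), ← hI s hs]
    exact ENNReal.ofReal_le_ofReal (hlow _ (hI0 s hs))
  have mup : ∀ s hs, m s hs ≤ lam.toNNReal * P s := fun s hs => by
    rw [← ofReal_measureReal (μ := P) (s := s), ← hI s hs, ← ENNReal.ofReal.eq_1 lam,
      ← ENNReal.ofReal_mul (by linarith)]
    exact ENNReal.ofReal_le_ofReal (hup _ (hI0 s hs))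
  have madd : ∀ s t (hs : MeasurableSet s) (ht : MeasurableSet t), Disjoint s t →
      m (s ∪ t) (hs.union ht) = m s hs + m t ht := fun s t hs ht hd => by
    simp only [m]
    rw [hadd s t hs ht hd, ENNReal.ofReal_add (hg0 s hs) (hg0 t ht)]
  have m0 : m ∅ MeasurableSet.empty = 0 := by
    simpa using mup ∅ MeasurableSet.empty
  have mfin : ∀ (f : ℕ → Set Ω) (h : ∀ i, MeasurableSet (f i)), Pairwise (Function.onFun Disjoint f) →
      ∀ n : ℕ, ∃ hn : MeasurableSet (⋃ i ∈ Finset.range n, f i),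
        m _ hn = ∑ i ∈ Finset.range n, m (f i) (h i) := by
    intro f h hd n
    refine ⟨Finset.measurableSet_biUnion _ fun i _ => h i, ?_⟩
    induction n with
    | zero => simpa using m0
    | succ n ih =>
      have hn : MeasurableSet (⋃ i ∈ Finset.range n, f i) :=
        Finset.measurableSet_biUnion _ fun i _ => h i
      have hdis : Disjoint (⋃ i ∈ Finset.range n, f i) (f n) := by
        rw [Set.disjoint_iUnion₂_left]
        intro i hi
        exact hd (Finset.mem_range.1 hi).ne
      rw [Finset.sum_range_succ, ← ih, ← madd _ _ hn (h n) hdis]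
      congr 1
      · rw [Finset.range_add_one, Finset.set_biUnion_insert, Set.union_comm]
      · exact Finset.measurableSet_biUnion _ fun i _ => h i
  have mmono : ∀ s t (hs : MeasurableSet s) (ht : MeasurableSet t), s ⊆ t → m s hs ≤ m t ht := by
    intro s t hs ht hst
    have := madd s (t \ s) hs (ht.diff hs) disjoint_sdiff_self_right
    simp only [Set.union_sdiff_cancel hst] at this
    rw [this]
    exact le_self_add
  have mU : ∀ ⦃f : ℕ → Set Ω⦄ (h : ∀ i, MeasurableSet (f i)),
      Pairwise (Function.onFun Disjoint f) →
        m (⋃ i, f i) (MeasurableSet.iUnion h) = ∑' i, m (f i) (h i) := by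
    intro f h hd
    apply le_antisymm
    -- The part of the union missed by the first `n` sets has `m`-mass at most `lam` times its
    -- `P`-mass, which tends to `0`.
    · have hlim : Tendsto (fun n : ℕ => ∑' i, m (f i) (h i)
          + lam.toNNReal * P ((⋃ i, f i) \ ⋃ i ∈ Finset.range n, f i)) atTop
          (𝓝 (∑' i, m (f i) (h i) + lam.toNNReal * 0)) := by
        refine tendsto_const_nhds.add (ENNReal.Tendsto.const_mul ?_ (Or.inr ENNReal.coe_ne_top))
        have hanti : Antitone fun n : ℕ => (⋃ i, f i) \ ⋃ i ∈ Finset.range n, f i := by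
          intro a b hab
          refine Set.sdiff_subset_sdiff_right (Set.biUnion_subset_biUnion_left ?_)
          intro i hi
          simp only [Finset.coe_range, Set.mem_Iio] at hi ⊢
          omega
        have := tendsto_measure_iInter_atTop (μ := P)
          (s := fun n : ℕ => (⋃ i, f i) \ ⋃ i ∈ Finset.range n, f i)
          (fun n => ((MeasurableSet.iUnion h).diff
            (Finset.measurableSet_biUnion _ fun i _ => h i)).nullMeasurableSet) hanti
          ⟨0, measure_ne_top _ _⟩
        have hempty : (⋂ n : ℕ, (⋃ i, f i) \ ⋃ i ∈ Finset.range n, f i) = ∅ := by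
          ext x
          simp only [Set.mem_iInter, Set.mem_sdiff, Set.mem_iUnion, Finset.mem_range,
            Set.mem_empty_iff_false, iff_false]
          intro hx
          obtain ⟨i, hi⟩ := (hx 0).1
          exact (hx (i + 1)).2 ⟨i, by omega, hi⟩
        rwa [hempty, measure_empty] at this
      rw [mul_zero, add_zero] at hlim
      refine ge_of_tendsto' hlim fun n => ?_
      obtain ⟨hn, hsum⟩ := mfin f h hd n
      have hsub : (⋃ i ∈ Finset.range n, f i) ⊆ ⋃ i, f i :=
        Set.iUnion₂_subset fun i _ => Set.subset_iUnion f i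
      have := madd _ _ hn ((MeasurableSet.iUnion h).diff hn) disjoint_sdiff_self_right
      simp only [Set.union_sdiff_cancel hsub] at this
      rw [this, hsum]
      exact add_le_add (ENNReal.sum_le_tsum _) (mup _ ((MeasurableSet.iUnion h).diff hn))
    · rw [ENNReal.tsum_eq_iSup_nat]
      refine iSup_le fun n => ?_
      obtain ⟨hn, hsum⟩ := mfin f h hd n
      rw [← hsum]
      exact mmono _ _ hn (MeasurableSet.iUnion h) (Set.iUnion₂_subset fun i _ => Set.subset_iUnion f i)
  let ν := Measure.ofMeasurable m m0 mU
  have hν : ∀ s hs, ν s = m s hs := fun s hs => Measure.ofMeasurable_apply s hs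
  have hν1 : P ≤ ν := Measure.le_iff.2 fun s hs => by rw [hν s hs]; exact mlow s hs
  have hν2 : ν ≤ lam.toNNReal • P := Measure.le_iff.2 fun s hs => by rw [hν s hs]; exact mup s hs
  have hac : ν ≪ P := Measure.absolutelyContinuous_of_le_smul hν2
  have hfinν : IsFiniteMeasure ν := ⟨(hν2 _).trans_lt (by simp)⟩
  have hintν : ∀ {f : Ω → ℝ}, Integrable f P → Integrable f ν := fun hf =>
    (hf.smul_measure_nnreal (c := lam.toNNReal)).mono_measure hν2
  have hgabs : ∀ f : integrableFunctions P, |g f| ≤ lam * ∫ ω, |f.1 ω| ∂P := by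
    intro f
    let fp : integrableFunctions P := ⟨fun ω => max (f.1 ω) 0, Integrable.pos_part f.2⟩
    let fm : integrableFunctions P := ⟨fun ω => max (-f.1 ω) 0, Integrable.neg_part f.2⟩
    have hf : f = fp - fm := Subtype.ext (by
      funext ω
      simp only [fp, fm, Submodule.coe_sub, Pi.sub_apply]
      rcases le_total 0 (f.1 ω) with h | h
      · rw [max_eq_left h, max_eq_right (by linarith)]; ring
      · rw [max_eq_right h, max_eq_left (by linarith)]; ring)
    have hp0 : 0 ≤ fp.1 := fun ω => le_max_right _ _
    have hm0 : 0 ≤ fm.1 := fun ω => le_max_right _ _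
    have hp := hup fp hp0
    have hm := hup fm hm0
    have hp' := (integral_nonneg hp0).trans (hlow fp hp0)
    have hm' := (integral_nonneg hm0).trans (hlow fm hm0)
    have hsum : ∫ ω, |f.1 ω| ∂P = ∫ ω, fp.1 ω ∂P + ∫ ω, fm.1 ω ∂P := by
      rw [← integral_add fp.2 fm.2]
      refine integral_congr_ae (Eventually.of_forall fun ω => ?_)
      simp only [fp, fm]
      rcases le_total 0 (f.1 ω) with h | h
      · rw [max_eq_left h, max_eq_right (by linarith), abs_of_nonneg h]; ring
      · rw [max_eq_right h, max_eq_left (by linarith), abs_of_nonpos h]; ring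
    have hgf : g f = g fp - g fm := by rw [← map_sub, ← hf]
    rw [hgf, hsum, abs_le]
    constructor <;> nlinarith
  -- `g` acts on functions, but its `L¹` bound makes it constant on almost-sure classes.
  have hae : ∀ f h : integrableFunctions P, f.1 =ᵐ[P] h.1 → g f = g h := by
    intro f h hfh
    have h0 : ∫ ω, |(f - h).1 ω| ∂P = 0 := by
      rw [← integral_zero Ω ℝ (μ := P)]
      refine integral_congr_ae ?_
      filter_upwards [hfh] with ω hω
      simp [hω]
    have := hgabs (f - h)
    rw [h0, mul_zero, map_sub] at this
    linarith [abs_nonpos_iff.1 this]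
  refine ⟨ν, hν1, hν2, ?_⟩
  rintro ⟨f, hf⟩
  refine Integrable.induction (μ := P) (P := fun f => ∀ hf : Integrable f P,
    g ⟨f, hf⟩ = ∫ ω, f ω ∂ν) ?_ ?_ ?_ ?_ hf hf
  · intro c s hs _ hf
    have : (⟨s.indicator fun _ => c, hf⟩ : integrableFunctions P) = c • I s hs :=
      Subtype.ext (by funext ω; by_cases h : ω ∈ s <;> simp [I, h])
    rw [this, map_smul, integral_indicator_const _ hs, measureReal_def, hν s hs,
      ENNReal.toReal_ofReal (hg0 s hs), smul_eq_mul, smul_eq_mul, mul_comm]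
  · intro f h _ hf hh ihf ihh hfh
    have : (⟨f + h, hfh⟩ : integrableFunctions P) = ⟨f, hf⟩ + ⟨h, hh⟩ := rfl
    rw [this, map_add, ihf hf, ihh hh]
    exact (integral_add (hintν hf) (hintν hh)).symm
  · have hcont : Continuous fun f : Ω →₁[P] ℝ =>
        g ⟨f, L1.integrable_coeFn f⟩ - ∫ ω, f ω ∂ν := by
      -- One `lam` bounds `g`, the other the integral against `ν ≤ lam • P`.
      refine LipschitzWith.continuous (K := 2 * lam.toNNReal) ?_
      refine LipschitzWith.of_dist_le_mul fun f h => ?_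
      have hfh := L1.integrable_coeFn (f - h)
      have hnorm : dist f h = ∫ ω, |(f - h : Ω →₁[P] ℝ) ω| ∂P := by
        rw [dist_eq_norm, L1.norm_eq_integral_norm]
        rfl
      have e1 : g ⟨f, L1.integrable_coeFn f⟩ - g ⟨h, L1.integrable_coeFn h⟩
          = g ⟨_, hfh⟩ := by
        rw [← map_sub]
        exact hae _ _ (Lp.coeFn_sub f h).symm
      have e2 : ∫ ω, f ω ∂ν - ∫ ω, h ω ∂ν = ∫ ω, (f - h : Ω →₁[P] ℝ) ω ∂ν := by
        rw [← integral_sub (hintν (L1.integrable_coeFn f)) (hintν (L1.integrable_coeFn h))]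
        exact integral_congr_ae (hac.ae_le (Lp.coeFn_sub f h).symm)
      have b1 := hgabs ⟨_, hfh⟩
      have b2 : |∫ ω, (f - h : Ω →₁[P] ℝ) ω ∂ν| ≤ lam * ∫ ω, |(f - h : Ω →₁[P] ℝ) ω| ∂P := by
        refine (abs_integral_le_integral_abs).trans ?_
        have := integral_mono_measure hν2 (Eventually.of_forall fun ω =>
          abs_nonneg ((f - h : Ω →₁[P] ℝ) ω)) (hfh.abs.smul_measure_nnreal (c := lam.toNNReal))
        rw [integral_smul_nnreal_measure, NNReal.smul_def, Real.coe_toNNReal _ (by linarith)] at this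
        exact this
      rw [Real.dist_eq, hnorm, NNReal.coe_mul, Real.coe_toNNReal _ (by linarith)]
      have : g ⟨f, L1.integrable_coeFn f⟩ - ∫ ω, f ω ∂ν
          - (g ⟨h, L1.integrable_coeFn h⟩ - ∫ ω, h ω ∂ν)
          = g ⟨_, hfh⟩ - ∫ ω, (f - h : Ω →₁[P] ℝ) ω ∂ν := by rw [← e1, ← e2]; ring
      rw [this]
      refine (abs_sub _ _).trans ?_
      change |g ⟨_, hfh⟩| ≤ lam * ∫ ω, |(f - h : Ω →₁[P] ℝ) ω| ∂P at b1
      change _ ≤ 2 * lam * ∫ ω, |(f - h : Ω →₁[P] ℝ) ω| ∂P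
      linarith
    have : {f : Ω →₁[P] ℝ | ∀ hf : Integrable f P, g ⟨f, hf⟩ = ∫ ω, f ω ∂ν}
        = {f : Ω →₁[P] ℝ | g ⟨f, L1.integrable_coeFn f⟩ - ∫ ω, f ω ∂ν = 0} := by
      ext f
      simp only [Set.mem_ofPred_eq, sub_eq_zero]
      exact ⟨fun h => h _, fun h _ => h⟩
    rw [this]
    exact isClosed_eq hcont continuous_const
  · intro f h hfh hf ih hh
    rw [← hae ⟨f, hf⟩ ⟨h, hh⟩ hfh, ih hf]
    exact integral_congr_ae (hac.ae_le hfh)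

/-- If the gains in a linear space `V` of integrable functions never exceed `lam` times the losses,
then a measure between `P` and `lam • P` annihilates `V`. -/
theorem exists_measure_integral_eq_zero {P : Measure Ω} [IsProbabilityMeasure P] {lam : ℝ}
    (hlam : 1 ≤ lam) (V : Submodule ℝ (Ω → ℝ)) (hV : ∀ K ∈ V, Integrable K P)
    (h : ∀ K ∈ V, ∫ ω, max (K ω) 0 ∂P ≤ lam * ∫ ω, max (-K ω) 0 ∂P) :
    ∃ ν : Measure Ω, P ≤ ν ∧ ν ≤ lam.toNNReal • P ∧ ∀ K ∈ V, ∫ ω, K ω ∂ν = 0 := by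
  -- For `lam ≥ 1`, `max f (lam * f)` is `lam * f⁺ - f⁻`. Its integral is nonnegative on `V` by the
  -- hypothesis applied to `-f`.
  obtain ⟨g, hg0, hgN⟩ := exists_extension_of_le_sublinear
    (E := integrableFunctions P) ⟨V.comap (integrableFunctions P).subtype, 0⟩
    (fun f => ∫ ω, max (f.1 ω) (lam * f.1 ω) ∂P)
    (by
      intro c hc f
      rw [← integral_const_mul]
      refine integral_congr_ae (Eventually.of_forall fun ω => ?_)
      simp only [SetLike.val_smul, Pi.smul_apply, smul_eq_mul]
      rw [mul_max_of_nonneg _ _ hc.le]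
      ring_nf)
    (by
      intro f k
      rw [← integral_add (integrable_max_mul f.2 lam) (integrable_max_mul k.2 lam)]
      refine integral_mono (integrable_max_mul (f + k).2 lam)
        ((integrable_max_mul f.2 lam).add (integrable_max_mul k.2 lam)) fun ω => ?_
      simp only [Submodule.coe_add, Pi.add_apply, mul_add]
      exact max_add_add_le_max_add_max)
    (by
      rintro ⟨⟨f, hf⟩, hfV⟩
      have hfV' : f ∈ V := hfV
      have h1 := h (-f) (V.neg_mem hfV')
      simp only [Pi.neg_apply, neg_neg] at h1
      have h2 : ∫ ω, max (f ω) (lam * f ω) ∂P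
          = lam * ∫ ω, max (f ω) 0 ∂P - ∫ ω, max (-f ω) 0 ∂P := by
        rw [← integral_const_mul, ← integral_sub (hf.pos_part.const_mul _) hf.neg_part]
        refine integral_congr_ae (Eventually.of_forall fun ω => ?_)
        simp only
        rcases le_total 0 (f ω) with h | h
        · rw [max_eq_left h, max_eq_right (b := 0) (by linarith), max_eq_right (by nlinarith)]
          ring
        · rw [max_eq_right h, max_eq_left (b := 0) (by linarith), max_eq_left (by nlinarith)]
          ring
      change (0 : ℝ) ≤ ∫ ω, max (f ω) (lam * f ω) ∂P
      linarith)
  obtain ⟨ν, h1, h2, h3⟩ := exists_measure_eq_integral hlam g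
    (by
      intro f hf
      have := hgN (-f)
      rw [map_neg] at this
      have e : ∫ ω, max ((-f).1 ω) (lam * (-f).1 ω) ∂P = - ∫ ω, f.1 ω ∂P := by
        rw [← integral_neg]
        refine integral_congr_ae (Eventually.of_forall fun ω => ?_)
        have h0 : 0 ≤ f.1 ω := hf ω
        have : (-f).1 ω = - f.1 ω := rfl
        simp only [this]
        rw [max_eq_left (by nlinarith)]
      linarith)
    (by
      intro f hf
      refine (hgN f).trans_eq ?_
      rw [← integral_const_mul]
      refine integral_congr_ae (Eventually.of_forall fun ω => ?_)
      have h0 : 0 ≤ f.1 ω := hf ω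
      simp only
      rw [max_eq_right (by nlinarith)])
  refine ⟨ν, h1, h2, fun K hK => ?_⟩
  rw [← h3 ⟨K, hV K hK⟩]
  exact hg0 ⟨⟨K, hV K hK⟩, hK⟩

end GainLoss

/-! ### Trading at deterministic dates and the martingale property. -/

namespace GainLoss

theorem sum_sub_castSucc {E : Type*} [AddCommGroup E] {n : ℕ} (f : Fin (n + 1) → E) :
    ∑ i : Fin n, (f i.succ - f i.castSucc) = f (Fin.last n) - f 0 := by
  rw [Finset.sum_sub_distrib, sub_eq_sub_iff_add_eq_add, add_comm, ← Fin.sum_univ_succ,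
    Fin.sum_univ_castSucc, add_comm]

/-- Telescoping `f` after clamping the index to `[a, b]`: increments outside the interval vanish. -/
theorem sum_ite_sub_castSucc {E : Type*} [AddCommGroup E] {n : ℕ} (f : Fin (n + 1) → E)
    {a b : Fin (n + 1)} (hab : a ≤ b) :
    ∑ i : Fin n, (if a ≤ i.castSucc ∧ i.succ ≤ b then f i.succ - f i.castSucc else 0)
      = f b - f a := by
  have h := sum_sub_castSucc fun k => f (min (max k a) b)
  have hlast : min (max (Fin.last n) a) b = b := by
    rw [max_eq_left (Fin.le_last a), min_eq_right (Fin.le_last b)]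
  have hzero : min (max 0 a) b = a := by
    rw [max_eq_right (Fin.zero_le a), min_eq_left hab]
  simp only [hlast, hzero] at h
  rw [← h]
  refine Finset.sum_congr rfl fun i _ => ?_
  split_ifs with hi
  · rw [max_eq_left (hi.1.trans (Fin.castSucc_le_succ i)), min_eq_left hi.2, max_eq_left hi.1,
      min_eq_left ((Fin.castSucc_le_succ i).trans hi.2)]
  · by_cases h1 : a ≤ i.castSucc
    · have h2 : b ≤ i.castSucc := by
        have : b < i.succ := not_le.1 fun h' => hi ⟨h1, h'⟩
        exact Fin.le_castSucc_iff.2 this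
      rw [min_eq_right ((h2.trans (Fin.castSucc_le_succ i)).trans (le_max_left _ _)),
        min_eq_right (h2.trans (le_max_left _ _)), sub_self]
    · have h2 : i.succ ≤ a := Fin.castSucc_lt_iff_succ_le.1 (not_le.1 h1)
      rw [max_eq_right h2, max_eq_right ((Fin.castSucc_le_succ i).trans h2), sub_self]

variable {Ω : Type*} [mΩ : MeasurableSpace Ω] {T : ℝ} {d : ℕ}
  {ℱ : Filtration (Set.Icc (0 : ℝ) T) mΩ} {S : Set.Icc (0 : ℝ) T → Ω → EuclideanSpace ℝ (Fin d)}

/-- The gains of holding a bounded position between two deterministic dates. -/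
def elementaryGains (ℱ : Filtration (Set.Icc (0 : ℝ) T) mΩ)
    (S : Set.Icc (0 : ℝ) T → Ω → EuclideanSpace ℝ (Fin d)) : Set (Ω → ℝ) :=
  {K | ∃ s t, s ≤ t ∧ ∃ h : Ω → EuclideanSpace ℝ (Fin d), Measurable[ℱ s] h ∧
    (∃ C : ℝ, ∀ ω, ‖h ω‖ ≤ C) ∧ K = fun ω => inner ℝ (h ω) (S t ω - S s ω)}

/-- `K` is the gain of a simple strategy with the deterministic trading dates `t`. -/
def IsGridGain (ℱ : Filtration (Set.Icc (0 : ℝ) T) mΩ)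
    (S : Set.Icc (0 : ℝ) T → Ω → EuclideanSpace ℝ (Fin d)) {n : ℕ}
    (t : Fin (n + 1) → Set.Icc (0 : ℝ) T) (K : Ω → ℝ) : Prop :=
  ∃ H : Fin n → Ω → EuclideanSpace ℝ (Fin d), (∀ i, Measurable[ℱ (t i.castSucc)] (H i)) ∧
    (∃ C : ℝ, ∀ i ω, ‖H i ω‖ ≤ C) ∧
    K = fun ω => ∑ i, inner ℝ (H i ω) (S (t i.succ) ω - S (t i.castSucc) ω)

theorem IsGridGain.mem_gains {n : ℕ} {t : Fin (n + 1) → Set.Icc (0 : ℝ) T} {K : Ω → ℝ}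
    (ht : StrictMono t) (hK : IsGridGain ℱ S t K) : K ∈ gains ℱ S := by
  obtain ⟨H, hH, hb, rfl⟩ := hK
  refine ⟨⟨n, fun i _ => t i, fun i => isStoppingTime_const ℱ (t i), fun _ => ht, H,
    fun i => ?_, hb⟩, rfl⟩
  have := IsStoppingTime.measurableSpace_const ℱ (t i.castSucc)
  exact (hH i).mono this.ge le_rfl

/-- Asking for every grid that contains `F` is what lets sums go through: two gains are written on a
common grid containing both finite sets, where positions add. -/
theorem exists_finset_isGridGain {K : Ω → ℝ} (hK : K ∈ Submodule.span ℝ (elementaryGains ℱ S)) :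
    ∃ F : Finset (Set.Icc (0 : ℝ) T), ∀ (n : ℕ) (t : Fin (n + 1) → Set.Icc (0 : ℝ) T),
      StrictMono t → (∀ x ∈ F, ∃ i, t i = x) → IsGridGain ℱ S t K := by
  classical
  induction hK using Submodule.span_induction with
  | mem K hK =>
    obtain ⟨r, u, hru, h, hh, ⟨C, hC⟩, rfl⟩ := hK
    refine ⟨{r, u}, fun n t ht hF => ?_⟩
    obtain ⟨a, rfl⟩ := hF r (by simp)
    obtain ⟨b, rfl⟩ := hF u (by simp)
    have hab : a ≤ b := ht.le_iff_le.1 hru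
    refine ⟨fun i => if a ≤ i.castSucc ∧ i.succ ≤ b then h else 0, fun i => ?_, ⟨C, fun i ω => ?_⟩,
      ?_⟩
    · dsimp only
      split_ifs with hi
      · exact hh.mono (ℱ.mono (ht.monotone hi.1)) le_rfl
      · exact measurable_const
    · dsimp only
      split_ifs with hi
      · exact hC ω
      · simpa using (norm_nonneg _).trans (hC ω)
    · funext ω
      rw [← sum_ite_sub_castSucc (fun i => S (t i) ω) hab, inner_sum]
      refine Finset.sum_congr rfl fun i _ => ?_
      dsimp only
      by_cases hi : a ≤ i.castSucc ∧ i.succ ≤ b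
      · rw [if_pos hi, if_pos hi]
      · rw [if_neg hi, if_neg hi, Pi.zero_apply, inner_zero_left, inner_zero_right]
  | zero =>
    exact ⟨∅, fun n t _ _ => ⟨fun _ => 0, fun _ => measurable_const, ⟨0, by simp⟩,
      by funext ω; simp⟩⟩
  | add K L _ _ ihK ihL =>
    obtain ⟨F, hF⟩ := ihK
    obtain ⟨G, hG⟩ := ihL
    refine ⟨F ∪ G, fun n t ht h => ?_⟩
    obtain ⟨H, hH, ⟨C, hC⟩, rfl⟩ := hF n t ht fun x hx => h x (Finset.mem_union_left _ hx)
    obtain ⟨J, hJ, ⟨D, hD⟩, rfl⟩ := hG n t ht fun x hx => h x (Finset.mem_union_right _ hx)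
    refine ⟨fun i => H i + J i, fun i => (hH i).add (hJ i), ⟨C + D, fun i ω => ?_⟩, ?_⟩
    · exact (norm_add_le _ _).trans (add_le_add (hC i ω) (hD i ω))
    · funext ω
      simp [inner_add_left, Finset.sum_add_distrib]
  | smul c K _ ih =>
    obtain ⟨F, hF⟩ := ih
    refine ⟨F, fun n t ht h => ?_⟩
    obtain ⟨H, hH, ⟨C, hC⟩, rfl⟩ := hF n t ht h
    refine ⟨fun i => c • H i, fun i => (hH i).const_smul c, ⟨|c| * C, fun i ω => ?_⟩, ?_⟩
    · change ‖c • H i ω‖ ≤ _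
      rw [norm_smul, Real.norm_eq_abs]
      exact mul_le_mul_of_nonneg_left (hC i ω) (abs_nonneg c)
    · funext ω
      simp [real_inner_smul_left, Finset.mul_sum]

theorem span_elementaryGains_subset_gains (hT : 0 ≤ T) :
    (Submodule.span ℝ (elementaryGains ℱ S) : Set (Ω → ℝ)) ⊆ gains ℱ S := by
  classical
  intro K hK
  obtain ⟨F, hF⟩ := exists_finset_isGridGain hK
  -- A strategy has `n + 1` dates, hence at least one; inserting `0` keeps the grid nonempty.
  let G := insert (⟨0, le_rfl, hT⟩ : Set.Icc (0 : ℝ) T) F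
  have hG : G.card = (G.card - 1) + 1 :=
    (Nat.succ_pred_eq_of_pos (Finset.card_pos.2 (Finset.insert_nonempty _ _))).symm
  refine IsGridGain.mem_gains (G.orderEmbOfFin hG).strictMono
    (hF _ _ (G.orderEmbOfFin hG).strictMono fun x hx => ?_)
  have : x ∈ Set.range (G.orderEmbOfFin hG) := by
    rw [Finset.range_orderEmbOfFin]
    exact Finset.mem_insert_of_mem hx
  exact this

theorem neg_mem_gains {K : Ω → ℝ} (hK : K ∈ gains ℱ S) : -K ∈ gains ℱ S := by
  obtain ⟨ξ, rfl⟩ := hK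
  obtain ⟨C, hC⟩ := ξ.bounded_H
  refine ⟨⟨ξ.n, ξ.τ, ξ.isStoppingTime, ξ.strictMono, fun i => -ξ.H i, fun i => ?_,
    C, fun i ω => ?_⟩, ?_⟩
  · exact (ξ.measurable_H i).neg
  · simpa using hC i ω
  · funext ω
    simp [SimpleStrategy.gain, inner_neg_left]

theorem integrable_inner_of_bounded {μ : Measure Ω} {E : Type*} [NormedAddCommGroup E]
    [InnerProductSpace ℝ E] {h f : Ω → E} {C : ℝ} (hh : AEStronglyMeasurable h μ)
    (hC : ∀ ω, ‖h ω‖ ≤ C) (hf : Integrable f μ) :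
    Integrable (fun ω => inner ℝ (h ω) (f ω)) μ := by
  refine Integrable.mono' (hf.norm.const_mul C) (hh.inner hf.1) (Eventually.of_forall fun ω => ?_)
  exact (norm_inner_le_norm _ _).trans (mul_le_mul_of_nonneg_right (hC ω) (norm_nonneg _))

theorem integrable_of_mem_span {μ : Measure Ω} (hS : ∀ t, Integrable (S t) μ)
    {K : Ω → ℝ} (hK : K ∈ Submodule.span ℝ (elementaryGains ℱ S)) : Integrable K μ := by
  induction hK using Submodule.span_induction with
  | mem K hK =>
    obtain ⟨s, t, _, h, hh, ⟨C, hC⟩, rfl⟩ := hK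
    exact integrable_inner_of_bounded (hh.mono (ℱ.le s) le_rfl).aestronglyMeasurable hC
      ((hS t).sub (hS s))
  | zero => exact integrable_zero _ _ _
  | add K L _ _ ihK ihL => exact ihK.add ihL
  | smul c K _ ih => exact ih.smul c

theorem martingale_of_setIntegral_eq {μ : Measure Ω} [IsFiniteMeasure μ]
    (hadapted : StronglyAdapted ℱ S) (hS : ∀ t, Integrable (S t) μ)
    (h : ∀ s t, s ≤ t → ∀ A, MeasurableSet[ℱ s] A → ∫ ω in A, S t ω ∂μ = ∫ ω in A, S s ω ∂μ) :
    Martingale S ℱ μ := by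
  refine ⟨hadapted, fun s t hst => ?_⟩
  exact (ae_eq_condExp_of_forall_setIntegral_eq (ℱ.le s) (hS t)
    (fun A _ _ => (hS s).integrableOn) (fun A hA _ => (h s t hst A hA).symm)
    (hadapted s).aestronglyMeasurable).symm

/-- Holding a fixed vector `v` on an event `A` known at time `s` tests the increment on `A` in
direction `v`. -/
theorem martingale_of_elementaryGains {μ : Measure Ω} [IsFiniteMeasure μ]
    (hadapted : StronglyAdapted ℱ S) (hS : ∀ t, Integrable (S t) μ)
    (h : ∀ K ∈ elementaryGains ℱ S, ∫ ω, K ω ∂μ = 0) : Martingale S ℱ μ := by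
  refine martingale_of_setIntegral_eq hadapted hS fun s t hst A hA => ?_
  rw [← sub_eq_zero, ← integral_sub (hS t).integrableOn (hS s).integrableOn]
  have hint : Integrable (fun ω => S t ω - S s ω) (μ.restrict A) :=
    ((hS t).sub (hS s)).integrableOn
  refine ext_inner_left ℝ fun v => ?_
  rw [← integral_inner hint, inner_zero_right, ← integral_indicator (ℱ.le s A hA)]
  refine Eq.trans ?_ (h _ ⟨s, t, hst, A.indicator fun _ => v, measurable_const.indicator hA,
    ⟨‖v‖, fun ω => norm_indicator_le_norm_self _ _⟩, rfl⟩)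
  refine integral_congr_ae (Eventually.of_forall fun ω => ?_)
  by_cases hω : ω ∈ A <;> simp [hω]

theorem integral_inner_sub_eq_zero {μ : Measure Ω} [IsFiniteMeasure μ] (hM : Martingale S ℱ μ)
    {s t : Set.Icc (0 : ℝ) T} (hst : s ≤ t) {h : Ω → EuclideanSpace ℝ (Fin d)}
    (hh : Measurable[ℱ s] h) {C : ℝ} (hC : ∀ ω, ‖h ω‖ ≤ C) :
    ∫ ω, inner ℝ (h ω) (S t ω - S s ω) ∂μ = 0 := by
  have hint : Integrable (S t - S s) μ := (hM.integrable t).sub (hM.integrable s)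
  have h1 := condExp_bilin_of_stronglyMeasurable_left (μ := μ) (m := ℱ s)
    (innerSL ℝ) (f := h) (g := S t - S s) hh.stronglyMeasurable
    (integrable_inner_of_bounded (hh.mono (ℱ.le s) le_rfl).aestronglyMeasurable hC hint) hint
  have h2 : μ[S t - S s | ℱ s] =ᵐ[μ] 0 := by
    filter_upwards [condExp_sub (hM.integrable t) (hM.integrable s) (ℱ s),
      hM.condExp_ae_eq hst, hM.condExp_ae_eq (le_refl s)] with ω e1 e2 e3
    rw [e1, Pi.sub_apply, e2, e3, sub_self, Pi.zero_apply]
  change ∫ ω, (fun ω => innerSL ℝ (h ω) ((S t - S s) ω)) ω ∂μ = 0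
  rw [← integral_condExp (ℱ.le s)]
  refine integral_eq_zero_of_ae ?_
  filter_upwards [h1, h2] with ω e1 e2
  rw [e1, e2]
  simp

end GainLoss

/-! ### Grid approximation and optional stopping. -/

namespace GainLoss

/-- The points of the grid of mesh `1 / (n + 1)` on `[0, T]`, stopped at `T`. -/
noncomputable def gridPoint {T : ℝ} (hT : 0 ≤ T) (n k : ℕ) : Set.Icc (0 : ℝ) T :=
  ⟨min T (k / (n + 1)), le_min hT (by positivity), min_le_left _ _⟩

/-- The first index of a point of the grid of mesh `1 / (n + 1)` at or after `t`. -/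
noncomputable def gridIndex {T : ℝ} (n : ℕ) (t : Set.Icc (0 : ℝ) T) : ℕ := ⌈(n + 1) * (t : ℝ)⌉₊

section Grid

variable {T : ℝ} (hT : 0 ≤ T)

theorem gridIndex_le_iff (n k : ℕ) (t : Set.Icc (0 : ℝ) T) :
    gridIndex n t ≤ k ↔ (t : ℝ) ≤ k / (n + 1) := by
  rw [gridIndex, Nat.ceil_le, le_div_iff₀' (by positivity)]

theorem gridIndex_le_iff_le_gridPoint (n k : ℕ) (t : Set.Icc (0 : ℝ) T) :
    gridIndex n t ≤ k ↔ t ≤ gridPoint hT n k := by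
  rw [gridIndex_le_iff, gridPoint, ← Subtype.coe_le_coe]
  simp [t.2.2]

/-- The grid point lies in `[t, t + 1 / (n + 1)]`. Approaching from the right means that only
right-continuity of paths is used. -/
theorem tendsto_gridPoint (t : Set.Icc (0 : ℝ) T) :
    Tendsto (fun n => gridPoint hT n (gridIndex n t)) atTop (𝓝[Set.Ici t] t) := by
  have hge : ∀ n, t ≤ gridPoint hT n (gridIndex n t) := fun n =>
    (gridIndex_le_iff_le_gridPoint hT n _ t).1 le_rfl
  refine tendsto_nhdsWithin_iff.2 ⟨?_, Eventually.of_forall hge⟩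
  rw [tendsto_subtype_rng]
  have hlim : Tendsto (fun n : ℕ => (t : ℝ) + 1 / ((n : ℝ) + 1)) atTop (𝓝 t) := by
    simpa using tendsto_const_nhds.add (tendsto_one_div_add_atTop_nhds_zero_nat (𝕜 := ℝ))
  refine tendsto_of_tendsto_of_tendsto_of_le_of_le tendsto_const_nhds hlim
    (fun n => hge n) fun n => ?_
  have hn : (0 : ℝ) < n + 1 := by positivity
  refine (min_le_right _ _).trans ?_
  rw [div_le_iff₀ hn, add_mul, one_div, inv_mul_cancel₀ hn.ne', mul_comm]
  exact (Nat.ceil_lt_add_one (mul_nonneg hn.le t.2.1)).le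

end Grid

section Paths

variable {Ω : Type*} {T : ℝ} {d : ℕ} {S : Set.Icc (0 : ℝ) T → Ω → EuclideanSpace ℝ (Fin d)}
  {τ : Ω → Set.Icc (0 : ℝ) T} {H : Ω → EuclideanSpace ℝ (Fin d)} {M : Ω → ℝ} {C : ℝ}

theorem norm_inner_sub_le {ω : Ω} (hC : ‖H ω‖ ≤ C) (hM : ∀ t, ‖S t ω‖ ≤ M ω)
    (u v : Set.Icc (0 : ℝ) T) : ‖inner ℝ (H ω) (S u ω - S v ω)‖ ≤ C * (M ω + M ω) :=
  (norm_inner_le_norm _ _).trans (mul_le_mul hC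
    ((norm_sub_le _ _).trans (add_le_add (hM u) (hM v))) (norm_nonneg _)
    ((norm_nonneg _).trans hC))

theorem tendsto_inner_gridPoint (hT : 0 ≤ T) {ω : Ω}
    (hrc : ∀ t, ContinuousWithinAt (fun t => S t ω) (Set.Ici t) t) (u : Set.Icc (0 : ℝ) T) :
    Tendsto (fun n => inner ℝ (H ω) (S u ω - S (gridPoint hT n (gridIndex n (τ ω))) ω)) atTop
      (𝓝 (inner ℝ (H ω) (S u ω - S (τ ω) ω))) :=
  tendsto_const_nhds.inner
    (tendsto_const_nhds.sub ((hrc (τ ω)).tendsto.comp (tendsto_gridPoint hT (τ ω))))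

theorem inner_gridPoint_eq_sum (hT : 0 ≤ T) (n : ℕ) (ω : Ω)
    (u : Set.Icc (0 : ℝ) T) :
    inner ℝ (H ω) (S u ω - S (gridPoint hT n (gridIndex n (τ ω))) ω)
      = ∑ k ∈ Finset.range (⌈(n + 1) * T⌉₊ + 1),
        inner ℝ ({ω | gridIndex n (τ ω) = k}.indicator H ω) (S u ω - S (gridPoint hT n k) ω) := by
  classical
  rw [Finset.sum_eq_single (gridIndex n (τ ω))]
  · simp
  · intro k _ hk
    have hk' : ω ∉ {ω | gridIndex n (τ ω) = k} := fun h => hk (Eq.symm h)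
    rw [Set.indicator_of_notMem hk', inner_zero_left]
  · intro h
    refine absurd (Finset.mem_range.2 (Nat.lt_succ_of_le (Nat.ceil_le_ceil ?_))) h
    exact mul_le_mul_of_nonneg_left (τ ω).2.2 (by positivity)

end Paths

variable {Ω : Type*} [mΩ : MeasurableSpace Ω] {T : ℝ} {d : ℕ}
  {ℱ : Filtration (Set.Icc (0 : ℝ) T) mΩ} {S : Set.Icc (0 : ℝ) T → Ω → EuclideanSpace ℝ (Fin d)}

/-- The supremum over all times need not be measurable. The one over the countably many grid points
is, and by right-continuity it still dominates almost every path. -/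
theorem exists_integrable_bound {μ : Measure Ω} (hT : 0 ≤ T) (hadapted : StronglyAdapted ℱ S)
    (hrc : ∀ᵐ ω ∂μ, ∀ t, ContinuousWithinAt (fun t => S t ω) (Set.Ici t) t)
    (hsup : ∫⁻ ω, ⨆ t, ‖S t ω‖ₑ ∂μ < ∞) :
    ∃ M : Ω → ℝ, Integrable M μ ∧ ∀ᵐ ω ∂μ, ∀ t, ‖S t ω‖ ≤ M ω := by
  let N : Ω → ℝ≥0∞ := fun ω => ⨆ p : ℕ × ℕ, ‖S (gridPoint hT p.1 p.2) ω‖ₑ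
  have hN : Measurable N := Measurable.iSup fun p =>
    ((hadapted _).mono (ℱ.le _)).measurable.enorm
  have hNfin : ∫⁻ ω, N ω ∂μ < ∞ := by
    refine (lintegral_mono fun ω => ?_).trans_lt hsup
    exact iSup_le fun p => le_iSup (fun t => ‖S t ω‖ₑ) (gridPoint hT p.1 p.2)
  refine ⟨fun ω => (N ω).toReal, integrable_toReal_of_lintegral_ne_top hN.aemeasurable hNfin.ne, ?_⟩
  filter_upwards [hrc, ae_lt_top hN hNfin.ne] with ω h1 h2 t
  have hle : ∀ t, ‖S t ω‖ₑ ≤ N ω := fun t =>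
    le_of_tendsto' ((h1 t).tendsto.comp (tendsto_gridPoint hT t)).enorm fun n =>
      le_iSup (fun p : ℕ × ℕ => ‖S (gridPoint hT p.1 p.2) ω‖ₑ) (n, gridIndex n t)
  simpa using ENNReal.toReal_mono h2.ne (hle t)

section Stopping

variable {τ : Ω → Set.Icc (0 : ℝ) T}

/-- The index is at most `j` exactly when `τ` is at most the `j`-th grid point, so the discretised
time takes its decision by that date. -/
theorem measurable_indicator_gridIndex (hT : 0 ≤ T)
    (hτ : IsStoppingTime ℱ fun ω => ((τ ω : Set.Icc (0 : ℝ) T) : WithTop _))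
    {H : Ω → EuclideanSpace ℝ (Fin d)} (hH : Measurable[hτ.measurableSpace] H) (n k : ℕ) :
    Measurable[ℱ (gridPoint hT n k)] ({ω | gridIndex n (τ ω) = k}.indicator H) := by
  have hle : ∀ A, MeasurableSet[hτ.measurableSpace] A → ∀ j ≤ k,
      MeasurableSet[ℱ (gridPoint hT n k)] (A ∩ {ω | gridIndex n (τ ω) ≤ j}) := by
    intro A hA j hj
    have hmono : gridPoint hT n j ≤ gridPoint hT n k := by
      rw [← gridIndex_le_iff_le_gridPoint]
      rw [gridIndex_le_iff]
      refine (min_le_right _ _).trans ?_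
      have : (j : ℝ) ≤ k := by exact_mod_cast hj
      gcongr
    have h := ℱ.mono hmono _ (hA.2 (gridPoint hT n j))
    simp only [WithTop.coe_le_coe, ← gridIndex_le_iff_le_gridPoint hT] at h
    exact h
  have heq : ∀ A, MeasurableSet[hτ.measurableSpace] A →
      MeasurableSet[ℱ (gridPoint hT n k)] (A ∩ {ω | gridIndex n (τ ω) = k}) := by
    intro A hA
    -- Index `k` is the difference of `≤ k` and `≤ k - 1`, which needs `k > 0` because natural
    -- subtraction truncates.
    rcases Nat.eq_zero_or_pos k with rfl | hk
    · simpa using hle A hA 0 le_rfl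
    · convert (hle A hA k le_rfl).diff (hle A hA (k - 1) (Nat.sub_le _ _)) using 1
      ext ω
      simp only [Set.mem_inter_iff, Set.mem_ofPred_eq, Set.mem_sdiff]
      constructor
      · rintro ⟨h1, h2⟩
        exact ⟨⟨h1, h2.le⟩, fun h => by omega⟩
      · rintro ⟨⟨h1, h2⟩, h3⟩
        refine ⟨h1, ?_⟩
        by_contra h4
        exact h3 ⟨h1, by omega⟩
  have hset : MeasurableSet[ℱ (gridPoint hT n k)] {ω | gridIndex n (τ ω) = k} := by
    simpa using heq _ MeasurableSet.univ
  intro U hU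
  rw [Set.indicator_preimage, Set.ite]
  refine MeasurableSet.union (heq _ (hH hU)) (MeasurableSet.diff ?_ hset)
  exact measurable_const hU

variable {μ : Measure Ω} {M : Ω → ℝ}
  {H : Ω → EuclideanSpace ℝ (Fin d)} {C : ℝ}

theorem integrable_inner_gridPoint (hT : 0 ≤ T)
    (hτ : IsStoppingTime ℱ fun ω => ((τ ω : Set.Icc (0 : ℝ) T) : WithTop _))
    (hS : ∀ t, Integrable (S t) μ) (hH : Measurable[hτ.measurableSpace] H) (hC : ∀ ω, ‖H ω‖ ≤ C)
    (n k : ℕ) (u : Set.Icc (0 : ℝ) T) :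
    Integrable (fun ω =>
      inner ℝ ({ω | gridIndex n (τ ω) = k}.indicator H ω) (S u ω - S (gridPoint hT n k) ω)) μ :=
  integrable_inner_of_bounded
    ((measurable_indicator_gridIndex hT hτ hH n k).mono (ℱ.le _) le_rfl).aestronglyMeasurable
    (fun ω => (norm_indicator_le_norm_self _ _).trans (hC ω)) ((hS u).sub (hS _))

theorem integrable_inner_stopped (hT : 0 ≤ T)
    (hτ : IsStoppingTime ℱ fun ω => ((τ ω : Set.Icc (0 : ℝ) T) : WithTop _))
    (hS : ∀ t, Integrable (S t) μ) (hM : Integrable M μ) (hbd : ∀ᵐ ω ∂μ, ∀ t, ‖S t ω‖ ≤ M ω)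
    (hrc : ∀ᵐ ω ∂μ, ∀ t, ContinuousWithinAt (fun t => S t ω) (Set.Ici t) t)
    (hH : Measurable[hτ.measurableSpace] H) (hC : ∀ ω, ‖H ω‖ ≤ C) (u : Set.Icc (0 : ℝ) T) :
    Integrable (fun ω => inner ℝ (H ω) (S u ω - S (τ ω) ω)) μ := by
  refine Integrable.mono' ((hM.add hM).const_mul C) ?_ ?_
  · refine aestronglyMeasurable_of_tendsto_ae atTop (fun n => ?_)
      (hrc.mono fun ω hω => tendsto_inner_gridPoint (τ := τ) (H := H) hT hω u)
    simp only [inner_gridPoint_eq_sum]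
    exact (integrable_finsetSum _ fun k _ =>
      integrable_inner_gridPoint hT hτ hS hH hC n k u).aestronglyMeasurable
  · exact hbd.mono fun ω hω => norm_inner_sub_le (hC ω) hω _ _

/-- Optional stopping at the terminal date, tested against a bounded position. -/
theorem integral_inner_stopped_eq_zero [IsFiniteMeasure μ] (hT : 0 ≤ T) (hmart : Martingale S ℱ μ)
    (hτ : IsStoppingTime ℱ fun ω => ((τ ω : Set.Icc (0 : ℝ) T) : WithTop _))
    (hM : Integrable M μ) (hbd : ∀ᵐ ω ∂μ, ∀ t, ‖S t ω‖ ≤ M ω)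
    (hrc : ∀ᵐ ω ∂μ, ∀ t, ContinuousWithinAt (fun t => S t ω) (Set.Ici t) t)
    (hH : Measurable[hτ.measurableSpace] H) (hC : ∀ ω, ‖H ω‖ ≤ C) :
    ∫ ω, inner ℝ (H ω) (S ⟨T, Set.right_mem_Icc.2 hT⟩ ω - S (τ ω) ω) ∂μ = 0 := by
  have hint := fun n k => integrable_inner_gridPoint hT hτ hmart.integrable hH hC n k
    ⟨T, Set.right_mem_Icc.2 hT⟩
  have hlim := tendsto_integral_of_dominated_convergence (μ := μ)
    (F := fun n ω => inner ℝ (H ω)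
      (S ⟨T, Set.right_mem_Icc.2 hT⟩ ω - S (gridPoint hT n (gridIndex n (τ ω))) ω))
    (f := fun ω => inner ℝ (H ω) (S ⟨T, Set.right_mem_Icc.2 hT⟩ ω - S (τ ω) ω))
    (fun ω => C * (M ω + M ω))
    (fun n => by
      simp only [inner_gridPoint_eq_sum]
      exact (integrable_finsetSum _ fun k _ => hint n k).aestronglyMeasurable)
    ((hM.add hM).const_mul C)
    (fun n => hbd.mono fun ω hω => norm_inner_sub_le (hC ω) hω _ _)
    (hrc.mono fun ω hω => tendsto_inner_gridPoint hT hω _)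
  refine tendsto_nhds_unique hlim (tendsto_const_nhds.congr fun n => ?_)
  simp only [inner_gridPoint_eq_sum]
  rw [integral_finsetSum _ fun k _ => hint n k]
  refine (Finset.sum_eq_zero fun k _ => ?_).symm
  exact integral_inner_sub_eq_zero hmart (gridPoint hT n k).2.2
    (measurable_indicator_gridIndex hT hτ hH n k)
    (fun ω => (norm_indicator_le_norm_self _ _).trans (hC ω))

end Stopping

variable {μ : Measure Ω} {M : Ω → ℝ}

/-- Each increment is a difference of two increments up to `T`, so optional stopping is needed for
one stopping time only. -/
theorem SimpleStrategy.gain_eq (hT : 0 ≤ T) (ξ : SimpleStrategy d ℱ) :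
    ξ.gain S = fun ω => ∑ i : Fin ξ.n,
      (inner ℝ (ξ.H i ω) (S ⟨T, Set.right_mem_Icc.2 hT⟩ ω - S (ξ.τ i.castSucc ω) ω)
        - inner ℝ (ξ.H i ω) (S ⟨T, Set.right_mem_Icc.2 hT⟩ ω - S (ξ.τ i.succ ω) ω)) := by
  funext ω
  refine Finset.sum_congr rfl fun i _ => ?_
  rw [← inner_sub_right, sub_sub_sub_cancel_left]

theorem SimpleStrategy.measurable_H_succ (ξ : SimpleStrategy d ℱ) (i : Fin ξ.n) :
    Measurable[(ξ.isStoppingTime i.succ).measurableSpace] (ξ.H i) :=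
  (ξ.measurable_H i).mono (IsStoppingTime.measurableSpace_mono _ _ fun ω =>
    WithTop.coe_le_coe.2 ((ξ.strictMono ω).monotone (Fin.castSucc_le_succ i))) le_rfl

theorem integrable_of_mem_gains (hT : 0 ≤ T) (hS : ∀ t, Integrable (S t) μ) (hM : Integrable M μ)
    (hbd : ∀ᵐ ω ∂μ, ∀ t, ‖S t ω‖ ≤ M ω)
    (hrc : ∀ᵐ ω ∂μ, ∀ t, ContinuousWithinAt (fun t => S t ω) (Set.Ici t) t)
    {K : Ω → ℝ} (hK : K ∈ gains ℱ S) : Integrable K μ := by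
  obtain ⟨ξ, rfl⟩ := hK
  obtain ⟨C, hC⟩ := ξ.bounded_H
  rw [ξ.gain_eq hT]
  refine integrable_finsetSum _ fun i _ => ?_
  exact (integrable_inner_stopped hT _ hS hM hbd hrc (ξ.measurable_H i) (hC i) _).sub
    (integrable_inner_stopped hT _ hS hM hbd hrc (ξ.measurable_H_succ i) (hC i) _)

theorem integral_eq_zero_of_mem_gains [IsFiniteMeasure μ] (hT : 0 ≤ T) (hmart : Martingale S ℱ μ)
    (hM : Integrable M μ) (hbd : ∀ᵐ ω ∂μ, ∀ t, ‖S t ω‖ ≤ M ω)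
    (hrc : ∀ᵐ ω ∂μ, ∀ t, ContinuousWithinAt (fun t => S t ω) (Set.Ici t) t)
    {K : Ω → ℝ} (hK : K ∈ gains ℱ S) : ∫ ω, K ω ∂μ = 0 := by
  obtain ⟨ξ, rfl⟩ := hK
  obtain ⟨C, hC⟩ := ξ.bounded_H
  rw [ξ.gain_eq hT]
  have h1 := fun i => integrable_inner_stopped hT _ hmart.integrable hM hbd hrc
    (ξ.measurable_H i) (hC i) ⟨T, Set.right_mem_Icc.2 hT⟩
  have h2 := fun i => integrable_inner_stopped hT _ hmart.integrable hM hbd hrc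
    (ξ.measurable_H_succ i) (hC i) ⟨T, Set.right_mem_Icc.2 hT⟩
  refine (integral_finsetSum _ fun i _ => (h1 i).sub (h2 i)).trans ?_
  refine Finset.sum_eq_zero fun i _ => ?_
  refine (integral_sub (h1 i) (h2 i)).trans ?_
  rw [integral_inner_stopped_eq_zero hT hmart _ hM hbd hrc (ξ.measurable_H i) (hC i),
    integral_inner_stopped_eq_zero hT hmart _ hM hbd hrc (ξ.measurable_H_succ i) (hC i), sub_zero]

end GainLoss

/-! ### Convexity, bounds on the gain-loss ratio, and the conclusion. -/

namespace GainLoss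

variable {Ω : Type*} [mΩ : MeasurableSpace Ω] {T : ℝ} {d : ℕ}
  {ℱ : Filtration (Set.Icc (0 : ℝ) T) mΩ} {S : Set.Icc (0 : ℝ) T → Ω → EuclideanSpace ℝ (Fin d)}
  {P : Measure Ω}

theorem smul_measure_mono (c : ℝ≥0) {μ ν : Measure Ω} (h : μ ≤ ν) : c • μ ≤ c • ν :=
  Measure.le_iff.2 fun s _ => by
    rw [Measure.smul_apply, Measure.smul_apply]
    exact mul_le_mul_right (h s) (c : ℝ≥0∞)

theorem convex_finiteEntropy_inter_martingaleMeasures [IsProbabilityMeasure P] (lam : ℝ) :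
    Convex ℝ≥0 (finiteEntropy P lam ∩ martingaleMeasures P ℱ S) := by
  rintro Q ⟨hQ, hQp, hQac, hQm⟩ Q' ⟨hR, hRp, hRac, hRm⟩ a b - - hab
  obtain ⟨-, c, hc, hc1, hc2⟩ := mem_finiteEntropy_iff.1 hQ
  obtain ⟨-, e, he, he1, he2⟩ := mem_finiteEntropy_iff.1 hR
  have hprob : IsProbabilityMeasure (a • Q + b • Q') := ⟨by
    rw [Measure.add_apply, Measure.smul_apply, Measure.smul_apply, measure_univ, measure_univ,
      ENNReal.smul_def, ENNReal.smul_def, smul_eq_mul, smul_eq_mul, mul_one, mul_one,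
      ← ENNReal.coe_add, hab, ENNReal.coe_one]⟩
  refine ⟨mem_finiteEntropy_iff.2 ⟨hprob, a * c + b * e, ?_, ?_, ?_⟩, hprob, ?_, ?_⟩
  · rcases eq_or_ne a 0 with rfl | ha
    · rw [zero_add] at hab
      simpa [hab] using he
    · have : 0 < a * c := mul_pos (pos_iff_ne_zero.2 ha) hc
      exact this.trans_le le_self_add
  · rw [add_smul, mul_smul, mul_smul]
    exact add_le_add (smul_measure_mono _ hc1) (smul_measure_mono _ he1)
  · have : lam.toNNReal * (a * c + b * e)
        = a * (lam.toNNReal * c) + b * (lam.toNNReal * e) := by ring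
    rw [this, add_smul, mul_smul a, mul_smul b]
    exact add_le_add (smul_measure_mono _ hc2) (smul_measure_mono _ he2)
  · exact (hQac.smul_left a).add_left (hRac.smul_left b)
  · have hi : ∀ t, Integrable (S t) (a • Q) ∧ Integrable (S t) (b • Q') := fun t =>
      ⟨(hQm.integrable t).smul_measure_nnreal, (hRm.integrable t).smul_measure_nnreal⟩
    -- Conditional expectation is not linear in the measure, but integrals over sets are.
    refine martingale_of_setIntegral_eq hQm.1 (fun t => (hi t).1.add_measure (hi t).2) ?_
    intro s t hst A hA
    have hsplit : ∀ u, ∫ ω in A, S u ω ∂(a • Q + b • Q')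
        = a • ∫ ω in A, S u ω ∂Q + b • ∫ ω in A, S u ω ∂Q' := fun u => by
      rw [Measure.restrict_add, integral_add_measure (hi u).1.integrableOn (hi u).2.integrableOn,
        Measure.restrict_smul, Measure.restrict_smul, integral_smul_nnreal_measure,
        integral_smul_nnreal_measure]
    rw [hsplit, hsplit, hQm.setIntegral_eq hst hA, hRm.setIntegral_eq hst hA]

theorem lintegral_pos_eq_neg_of_integral_eq_zero {μ : Measure Ω} {K : Ω → ℝ} (hK : Integrable K μ)
    (h0 : ∫ ω, K ω ∂μ = 0) :
    ∫⁻ ω, ENNReal.ofReal (max (K ω) 0) ∂μ = ∫⁻ ω, ENNReal.ofReal (max (-K ω) 0) ∂μ := by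
  rw [← ofReal_integral_eq_lintegral_ofReal hK.pos_part
      (Eventually.of_forall fun ω => le_max_right _ _),
    ← ofReal_integral_eq_lintegral_ofReal hK.neg_part
      (Eventually.of_forall fun ω => le_max_right _ _)]
  congr 1
  rw [← sub_eq_zero, ← integral_sub hK.pos_part hK.neg_part]
  refine Eq.trans ?_ h0
  refine integral_congr_ae (Eventually.of_forall fun ω => ?_)
  simp only
  rcases le_total 0 (K ω) with h | h
  · rw [max_eq_left h, max_eq_right (by linarith), sub_zero]
  · rw [max_eq_right h, max_eq_left (by linarith), zero_sub, neg_neg]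

/-- An integrable variable that has mean zero under a measure between `c • P` and `lam * c • P` has
gain-loss ratio at most `lam`. -/
theorem gainLossRatio_le {Q : Measure Ω} {lam c : ℝ≥0} (hc : 0 < c) (hlow : c • P ≤ Q)
    (hup : Q ≤ (lam * c) • P) {K : Ω → ℝ} (hK : Integrable K Q) (h0 : ∫ ω, K ω ∂Q = 0) :
    gainLossRatio P K ≤ lam := by
  refine ENNReal.div_le_of_le_mul ?_
  have hc0 : (c : ℝ≥0∞) ≠ 0 := by exact_mod_cast hc.ne'
  rw [← ENNReal.mul_le_mul_iff_right hc0 ENNReal.coe_ne_top]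
  have h1 := lintegral_mono' hlow (le_refl fun ω => ENNReal.ofReal (max (K ω) 0))
  have h2 := lintegral_mono' hup (le_refl fun ω => ENNReal.ofReal (max (-K ω) 0))
  rw [lintegral_smul_measure, ENNReal.smul_def, smul_eq_mul] at h1 h2
  refine h1.trans ((lintegral_pos_eq_neg_of_integral_eq_zero hK h0).trans_le (h2.trans_eq ?_))
  push_cast
  ring

theorem integral_pos_le_of_gainLossRatio_le {lam : ℝ} (hlam : 0 ≤ lam) {K : Ω → ℝ}
    (hK : Integrable K P) (h : ¬ K =ᵐ[P] 0 → gainLossRatio P K ≤ ENNReal.ofReal lam) :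
    ∫ ω, max (K ω) 0 ∂P ≤ lam * ∫ ω, max (-K ω) 0 ∂P := by
  by_cases hK0 : K =ᵐ[P] 0
  · have h1 : ∫ ω, max (K ω) 0 ∂P = 0 :=
      integral_eq_zero_of_ae (hK0.mono fun ω hω => by simp [hω])
    rw [h1]
    exact mul_nonneg hlam (integral_nonneg fun ω => le_max_right _ _)
  have hr := h hK0
  have hp0 : 0 ≤ ∫ ω, max (K ω) 0 ∂P := integral_nonneg fun ω => le_max_right _ _
  have hm0 : 0 ≤ ∫ ω, max (-K ω) 0 ∂P := integral_nonneg fun ω => le_max_right _ _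
  rw [gainLossRatio, ← ofReal_integral_eq_lintegral_ofReal hK.pos_part
      (Eventually.of_forall fun ω => le_max_right _ _),
    ← ofReal_integral_eq_lintegral_ofReal hK.neg_part
      (Eventually.of_forall fun ω => le_max_right _ _)] at hr
  -- If `E[K⁻] = 0`, a finite ratio forces `E[K⁺] = 0`, since `x / 0 = ∞` for `x ≠ 0`.
  rcases hm0.eq_or_lt with hm | hm
  · rw [← hm, mul_zero]
    rw [← hm, ENNReal.ofReal_zero] at hr
    by_contra hp
    rw [ENNReal.div_zero (by simpa using hp)] at hr
    exact absurd hr (by simp)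
  · rw [ENNReal.div_le_iff (by simpa using hm) ENNReal.ofReal_ne_top,
      ← ENNReal.ofReal_mul hlam] at hr
    exact (ENNReal.ofReal_le_ofReal_iff (mul_nonneg hlam hm0)).1 hr

theorem one_le_max_gainLossRatio {K : Ω → ℝ} (hK : Integrable K P) (hK0 : ¬ K =ᵐ[P] 0) :
    1 ≤ gainLossRatio P K ∨ 1 ≤ gainLossRatio P (-K) := by
  have key : ∀ {L : Ω → ℝ}, Integrable L P → ¬ L =ᵐ[P] 0 →
      ∫⁻ ω, ENNReal.ofReal (max (-L ω) 0) ∂P ≤ ∫⁻ ω, ENNReal.ofReal (max (L ω) 0) ∂P →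
      1 ≤ gainLossRatio P L := by
    intro L hL hL0 hle
    have hfin : ∫⁻ ω, ENNReal.ofReal (max (-L ω) 0) ∂P ≠ ∞ := hL.neg_part.lintegral_lt_top.ne
    -- Since `0 / 0 = 0` in `ℝ≥0∞`, a vanishing loss needs `L` not null to make the ratio `∞`.
    by_cases hz : ∫⁻ ω, ENNReal.ofReal (max (-L ω) 0) ∂P = 0
    · have hp : ∫⁻ ω, ENNReal.ofReal (max (L ω) 0) ∂P ≠ 0 := by
        intro hp
        apply hL0
        rw [lintegral_eq_zero_iff' hL.pos_part.1.aemeasurable.ennreal_ofReal] at hp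
        rw [lintegral_eq_zero_iff' hL.neg_part.1.aemeasurable.ennreal_ofReal] at hz
        filter_upwards [hp, hz] with ω h1 h2
        simp only [Pi.zero_apply, ENNReal.ofReal_eq_zero, max_le_iff] at h1 h2 ⊢
        linarith [h1.1, h2.1]
      rw [gainLossRatio, hz, ENNReal.div_zero hp]
      exact le_top
    · rw [gainLossRatio, ENNReal.le_div_iff_mul_le (Or.inl hz) (Or.inl hfin), one_mul]
      exact hle
  rcases le_total (∫⁻ ω, ENNReal.ofReal (max (-K ω) 0) ∂P)
    (∫⁻ ω, ENNReal.ofReal (max (K ω) 0) ∂P) with h | h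
  · exact Or.inl (key hK hK0 h)
  · refine Or.inr (key hK.neg (fun h0 => hK0 ?_) (by simpa using h))
    filter_upwards [h0] with ω hω
    simpa using hω

theorem gainLossRatio_le_bestGainLoss {K : Ω → ℝ} (hK : K ∈ gains ℱ S) (hK0 : ¬ K =ᵐ[P] 0) :
    gainLossRatio P K ≤ bestGainLoss P ℱ S :=
  le_iSup₂_of_le K ⟨hK, hK0⟩ le_rfl

theorem one_le_bestGainLoss {K : Ω → ℝ} (hKint : Integrable K P) (hK : K ∈ gains ℱ S)
    (hK0 : ¬ K =ᵐ[P] 0) : 1 ≤ bestGainLoss P ℱ S := by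
  rcases one_le_max_gainLossRatio hKint hK0 with h | h
  · exact h.trans (gainLossRatio_le_bestGainLoss hK hK0)
  · refine h.trans (gainLossRatio_le_bestGainLoss (neg_mem_gains hK) fun h0 => hK0 ?_)
    filter_upwards [h0] with ω hω
    simpa using hω

/-- If the best gain-loss ratio is at most `lam`, there is a martingale measure of finite entropy
for `lam`. -/
theorem nonempty_finiteEntropy_inter_martingaleMeasures [IsProbabilityMeasure P] (hT : 0 ≤ T)
    (hadapted : StronglyAdapted ℱ S) (hS : ∀ t, Integrable (S t) P) {lam : ℝ} (hlam : 1 ≤ lam)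
    (h : bestGainLoss P ℱ S ≤ ENNReal.ofReal lam) :
    (finiteEntropy P lam ∩ martingaleMeasures P ℱ S).Nonempty := by
  obtain ⟨ν, h1, h2, h3⟩ := exists_measure_integral_eq_zero hlam
    (Submodule.span ℝ (elementaryGains ℱ S)) (fun K hK => integrable_of_mem_span hS hK)
    fun K hK => integral_pos_le_of_gainLossRatio_le (zero_le_one.trans hlam)
      (integrable_of_mem_span hS hK) fun hK0 => (gainLossRatio_le_bestGainLoss
        (span_elementaryGains_subset_gains hT hK) hK0).trans h
  have hfin : IsFiniteMeasure ν := ⟨(h2 _).trans_lt (by simp)⟩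
  have hac : ν ≪ P := Measure.absolutelyContinuous_of_le_smul h2
  have hmass : ((ν Set.univ).toNNReal : ℝ≥0∞) = ν Set.univ := ENNReal.coe_toNNReal (measure_ne_top _ _)
  have hpos : 0 < (ν Set.univ).toNNReal := by
    have : (1 : ℝ≥0∞) ≤ (ν Set.univ).toNNReal := by
      rw [hmass, ← measure_univ (μ := P)]
      exact h1 _
    exact zero_lt_one.trans_le (by exact_mod_cast this)
  let c : ℝ≥0 := (ν Set.univ).toNNReal⁻¹
  have hc : 0 < c := inv_pos.2 hpos
  have hprob : IsProbabilityMeasure (c • ν) := ⟨by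
    rw [Measure.smul_apply, ENNReal.smul_def, smul_eq_mul, ← hmass, ← ENNReal.coe_mul,
      inv_mul_cancel₀ hpos.ne', ENNReal.coe_one]⟩
  refine ⟨c • ν, mem_finiteEntropy_iff.2 ⟨hprob, c, hc, ?_, ?_⟩, hprob, hac.smul_left c, ?_⟩
  · exact smul_measure_mono _ h1
  · rw [mul_comm, mul_smul]
    exact smul_measure_mono _ h2
  · refine martingale_of_elementaryGains hadapted (fun t => ?_) fun K hK => ?_
    · exact (((hS t).smul_measure_nnreal (c := lam.toNNReal)).mono_measure h2).smul_measure_nnreal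
    · rw [integral_smul_nnreal_measure, h3 K (Submodule.subset_span hK), smul_zero]

theorem bestGainLoss_le [IsProbabilityMeasure P] (hT : 0 ≤ T) {M : Ω → ℝ} (hM : Integrable M P)
    (hbd : ∀ᵐ ω ∂P, ∀ t, ‖S t ω‖ ≤ M ω)
    (hrc : ∀ᵐ ω ∂P, ∀ t, ContinuousWithinAt (fun t => S t ω) (Set.Ici t) t) {lam : ℝ}
    (h : (finiteEntropy P lam ∩ martingaleMeasures P ℱ S).Nonempty) :
    bestGainLoss P ℱ S ≤ ENNReal.ofReal lam := by
  obtain ⟨Q, hQ, -, hac, hmart⟩ := h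
  obtain ⟨hprob, c, hc, h1, h2⟩ := mem_finiteEntropy_iff.1 hQ
  have hMQ : Integrable M Q := hM.smul_measure_nnreal.mono_measure h2
  have hbdQ : ∀ᵐ ω ∂Q, ∀ t, ‖S t ω‖ ≤ M ω := hac.ae_le hbd
  have hrcQ : ∀ᵐ ω ∂Q, ∀ t, ContinuousWithinAt (fun t => S t ω) (Set.Ici t) t := hac.ae_le hrc
  refine iSup₂_le fun K hK => ?_
  exact gainLossRatio_le hc h1 h2
    (integrable_of_mem_gains hT hmart.integrable hMQ hbdQ hrcQ hK.1)
    (integral_eq_zero_of_mem_gains hT hmart hMQ hbdQ hrcQ hK.1)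

theorem finiteEntropy_one [IsProbabilityMeasure P] : finiteEntropy P 1 = {P} := by
  ext Q
  rw [mem_finiteEntropy_iff, Set.mem_singleton_iff]
  constructor
  · rintro ⟨hQ, c, -, h1, h2⟩
    rw [Real.toNNReal_one, one_mul] at h2
    have heq : Q = c • P := le_antisymm h2 h1
    have hc : (c : ℝ≥0∞) = 1 := by
      have h : Q Set.univ = (c • P) Set.univ := congrArg (fun μ : Measure Ω => μ Set.univ) heq
      rw [Measure.smul_apply, measure_univ, measure_univ, ENNReal.smul_def, smul_eq_mul,
        mul_one] at h
      exact h.symm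
    have hc' : c = 1 := by exact_mod_cast hc
    rw [heq, hc', one_smul]
  · rintro rfl
    exact ⟨inferInstance, 1, zero_lt_one, by simp, by simp⟩

end GainLoss

theorem mainTheorem4 {Ω : Type*} [MeasurableSpace Ω] (P : Measure Ω) [IsProbabilityMeasure P]
    (T : ℝ) (hT : 0 ≤ T) (d : ℕ)
    (ℱ : Filtration (Set.Icc (0 : ℝ) T) ‹MeasurableSpace Ω›)
    (S : Set.Icc (0 : ℝ) T → Ω → EuclideanSpace ℝ (Fin d))
    (hS_adapted : StronglyAdapted ℱ S)
    (hS_cadlag : ∀ᵐ ω ∂P, GainLoss.IsCadlag fun t => S t ω)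
    (hS_sup : ∫⁻ ω, ⨆ t, ‖S t ω‖ₑ ∂P < ∞) :
    (∀ lam : ℝ, 1 ≤ lam →
      Convex ℝ≥0 (GainLoss.finiteEntropy P lam ∩ GainLoss.martingaleMeasures P ℱ S)) ∧
    (GainLoss.bestGainLoss P ℱ S < ∞ ↔
      ∃ lam : ℝ, 1 ≤ lam ∧
        (GainLoss.finiteEntropy P lam ∩ GainLoss.martingaleMeasures P ℱ S).Nonempty) ∧
    ((∃ K ∈ GainLoss.gains ℱ S, ¬ K =ᵐ[P] 0) →
      (GainLoss.bestGainLoss P ℱ S < ∞ →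
        IsLeast {lam : ℝ | 1 ≤ lam ∧
            (GainLoss.finiteEntropy P lam ∩ GainLoss.martingaleMeasures P ℱ S).Nonempty}
          (GainLoss.bestGainLoss P ℱ S).toReal) ∧
      (GainLoss.bestGainLoss P ℱ S = 1 ↔ P ∈ GainLoss.martingaleMeasures P ℱ S)) := by
  have hrc : ∀ᵐ ω ∂P, ∀ t, ContinuousWithinAt (fun t => S t ω) (Set.Ici t) t :=
    hS_cadlag.mono fun ω hω t => (hω t).1
  obtain ⟨M, hM, hbd⟩ := GainLoss.exists_integrable_bound hT hS_adapted hrc hS_sup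
  have hS : ∀ t, Integrable (S t) P := fun t =>
    hM.mono' ((hS_adapted t).mono (ℱ.le t)).aestronglyMeasurable (hbd.mono fun ω hω => hω t)
  have hexists := fun {lam : ℝ} (hlam : 1 ≤ lam) =>
    GainLoss.nonempty_finiteEntropy_inter_martingaleMeasures (P := P) hT hS_adapted hS hlam
  have hle := fun {lam : ℝ} => GainLoss.bestGainLoss_le (ℱ := ℱ) hT hM hbd hrc (lam := lam)
  refine ⟨fun lam _ => GainLoss.convex_finiteEntropy_inter_martingaleMeasures lam, ⟨?_, ?_⟩, ?_⟩
  · intro hfin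
    -- The maximum with `1` covers the case where all gains are null and `α* = 0`.
    refine ⟨max 1 (GainLoss.bestGainLoss P ℱ S).toReal, le_max_left _ _,
      hexists (le_max_left _ _) ?_⟩
    exact (ENNReal.ofReal_toReal hfin.ne).ge.trans (ENNReal.ofReal_le_ofReal (le_max_right _ _))
  · rintro ⟨lam, -, hne⟩
    exact (hle hne).trans_lt ENNReal.ofReal_lt_top
  · rintro ⟨K, hK, hK0⟩
    have hone : 1 ≤ GainLoss.bestGainLoss P ℱ S := GainLoss.one_le_bestGainLoss
      (GainLoss.integrable_of_mem_gains hT hS hM hbd hrc hK) hK hK0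
    refine ⟨fun hfin => ⟨?_, ?_⟩, ⟨fun h1 => ?_, fun hP => ?_⟩⟩
    · have h1 : 1 ≤ (GainLoss.bestGainLoss P ℱ S).toReal := by
        simpa using ENNReal.toReal_mono hfin.ne hone
      exact ⟨h1, hexists h1 (ENNReal.ofReal_toReal hfin.ne).ge⟩
    · rintro lam ⟨hlam, hne⟩
      exact ENNReal.toReal_le_of_le_ofReal (zero_le_one.trans hlam) (hle hne)
    · obtain ⟨Q, hQ, hQm⟩ := hexists le_rfl (h1.trans ENNReal.ofReal_one.symm).le
      rw [GainLoss.finiteEntropy_one, Set.mem_singleton_iff] at hQ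
      exact hQ ▸ hQm
    · refine le_antisymm ?_ hone
      rw [← ENNReal.ofReal_one]
      refine hle ⟨P, ?_, hP⟩
      rw [GainLoss.finiteEntropy_one]
      exact Set.mem_singleton P
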